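/- Let $r\ge 1$ and $s\ge 2$ be integers, and let $P_1,\dots,P_s\in\mathbb{Z}[x_1,\dots,x_r]$ be nonzero polynomials that are coprime over $\mathbb{Q}$, i.e. no polynomial $D\in\mathbb{Q}[x_1,\dots,x_r]$ with $\deg D>0$ divides each of $P_1,\dots,P_s$. Let $$\mathcal{R}=\{\underline n\in\mathbb{Z}^r : \gcd(P_1(\underline n),\dots,P_s(\underline n))=1\},$$ and for each prime $p$ let $$c_p=\#\{\underline n\in(\mathbb{Z}/p\mathbb{Z})^r : P_1(\underline n)=\dots=P_s(\underline n)=0 \text{ in } \mathbb{Z}/p\mathbb{Z}\}.$$ Then the product $\prod_p\left(1-\frac{c_p}{p^r}\right)$ over all primes $p$ converges (unconditionally; its value may be $0$), the limit below exists, and $$\lim_{B\to+\infty}\frac{\#\left(\mathcal{R}\cap\{0,1,\dots,B-1\}^r\right)}{B^r}=\prod_{p\text{ prime}}\left(1-\frac{c_p}{p^r}\right).$$ -/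

import Mathlib

namespace EkedahlPoonen

/-- A finite family of polynomials over `ℤ` is coprime (over the field `ℚ`): no polynomial of
positive degree in `ℚ[x₁,…,x_r]` divides all of its members. -/
def CoprimePolys {r s : ℕ} (P : Fin s → MvPolynomial (Fin r) ℤ) : Prop :=
  ¬ ∃ D : MvPolynomial (Fin r) ℚ, 0 < D.totalDegree ∧
    ∀ i, D ∣ MvPolynomial.map (Int.castRingHom ℚ) (P i)

/-- The set of integer points at which the values of the family are (setwise) coprime. -/
def coprimeValueSet {r s : ℕ} (P : Fin s → MvPolynomial (Fin r) ℤ) : Set (Fin r → ℤ) :=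
  {n | Finset.univ.gcd (fun i => MvPolynomial.eval n (P i)) = 1}

/-- The box `{0, …, B - 1}^r` in `ℤ^r`. -/
noncomputable def box (r B : ℕ) : Finset (Fin r → ℤ) :=
  Fintype.piFinset fun _ => Finset.Ico (0 : ℤ) (B : ℤ)

/-- The set `S ⊆ ℤ^r` has natural density `d` (the limit exists and equals `d`), computed along
the boxes `{0, …, B - 1}^r`. -/
def HasDensity {r : ℕ} (S : Set (Fin r → ℤ)) (d : ℝ) : Prop :=
  Filter.Tendsto
    (fun B : ℕ => ((S ∩ (box r B : Set (Fin r → ℤ))).ncard : ℝ) / ((box r B).card : ℝ))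
    Filter.atTop (nhds d)

/-- The number of common zeros in `(ℤ/pℤ)^r` of the reductions of the family modulo `p`. -/
noncomputable def commonZeros {r s : ℕ} (P : Fin s → MvPolynomial (Fin r) ℤ) (p : ℕ) : ℕ :=
  Set.ncard {x : Fin r → ZMod p |
    ∀ i, MvPolynomial.eval x (MvPolynomial.map (Int.castRingHom (ZMod p)) (P i)) = 0}

end EkedahlPoonen

/-!
Points surviving the sieve by finitely many primes have the expected density, by the Chinese
remainder theorem. The work is to show that the points at which some prime `p > M` divides all
values have upper density tending to `0` as `M → ∞` (Ekedahl, Poonen), by induction on `r`.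
Eliminating the first variable gives a polynomial `g ≠ 0` in the others that lies in the ideal
generated by the family, so that such a `p` divides `g (x₂, …, x_r)`. If `p` divides all
coefficients with respect to the first variable at `(x₂, …, x_r)`, induction applies to the family
of these coefficients. Otherwise the line through the point in the first direction contains at most
`d` zeros modulo `p`, where `d` is the degree. A prime `p ≤ B` thus contributes `O(1 / p ^ 2)`; and
outside the zeros of `g`, only boundedly many primes `p > B` divide `g (x₂, …, x_r)`, each leaving
`O(1)` points of the line.

The product converges because, for `M` large, its finite partial products over primes `p > M` are
densities of sets whose complements have upper density at most `1 / 2`. These products are thus at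
least `1 / 2`, which bounds the sums of `c_p / p ^ r`.
-/

namespace EkedahlPoonen

open Filter Topology

section Elimination

open Polynomial

theorem span_eq_top_of_forall_dvd_natDegree_eq_zero {K : Type*} [Field K] {S : Set K[X]}
    (hS : ∀ D : K[X], (∀ f ∈ S, D ∣ f) → D.natDegree = 0) : Ideal.span S = ⊤ := by
  obtain ⟨D, hspan : Ideal.span S = Ideal.span {D}⟩ :=
    IsPrincipalIdealRing.principal (Ideal.span S)
  have hD : ∀ f ∈ S, D ∣ f := fun f hf =>
    Ideal.mem_span_singleton.1 (hspan ▸ Ideal.subset_span hf)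
  have hD0 : D ≠ 0 := by
    rintro rfl
    have hX : (X : K[X]).natDegree = 0 := hS X fun f hf => zero_dvd_iff.1 (hD f hf) ▸ dvd_zero X
    simp at hX
  rw [hspan]
  exact Ideal.span_singleton_eq_top.2
    (isUnit_iff_degree_eq_zero.2 (degree_eq_iff_natDegree_eq hD0 |>.2 (hS D hD)))

variable {A : Type*} [CommRing A] [IsDomain A] {K : Type*} [Field K] [Algebra A K]
  [IsFractionRing A K]

theorem exists_C_mem_of_map_eq_top {I : Ideal A[X]}
    (hI : I.map (mapRingHom (algebraMap A K)) = ⊤) : ∃ a : A, a ≠ 0 ∧ C a ∈ I := by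
  let : Algebra A[X] K[X] := Polynomial.algebra A K
  have := Polynomial.isLocalization (nonZeroDivisors A) K
  have hone : (1 : K[X]) ∈ I.map (algebraMap A[X] K[X]) := (Ideal.eq_top_iff_one _).1 hI
  obtain ⟨⟨f, ⟨_, a, ha, rfl⟩⟩, hf⟩ :=
    (IsLocalization.mem_map_algebraMap_iff ((nonZeroDivisors A).map (C : A →+* A[X])) K[X]).1 hone
  have hinj : Function.Injective (algebraMap A[X] K[X]) :=
    Polynomial.map_injective _ (IsFractionRing.injective A K)
  rw [one_mul] at hf
  exact ⟨a, nonZeroDivisors.ne_zero ha, (hinj hf : C a = f) ▸ f.2⟩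

theorem exists_isPrimitive_map_dvd [NormalizedGCDMonoid A] (D : K[X]) :
    ∃ N : A[X], N.IsPrimitive ∧ N.map (algebraMap A K) ∣ D ∧ N.natDegree = D.natDegree := by
  obtain ⟨b, hb, hbN⟩ := IsLocalization.integerNormalization_spec (nonZeroDivisors A) D
  set N := IsLocalization.integerNormalization (nonZeroDivisors A) D
  have hb0 : algebraMap A K b ≠ 0 := by simpa using nonZeroDivisors.ne_zero hb
  rw [Algebra.smul_def, Polynomial.algebraMap_apply] at hbN
  refine ⟨N.primPart, N.isPrimitive_primPart, ?_, ?_⟩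
  · have hdvd : N.primPart.map (algebraMap A K) ∣ C (algebraMap A K b) * D :=
      hbN ▸ Polynomial.map_dvd _ N.primPart_dvd
    exact (isUnit_C.2 hb0.isUnit).dvd_mul_left.1 hdvd
  · rw [natDegree_primPart, ← natDegree_map_eq_of_injective (IsFractionRing.injective A K) N, hbN,
      natDegree_C_mul hb0]

theorem natDegree_eq_zero_of_forall_dvd_map [UniqueFactorizationMonoid A] {S : Set A[X]}
    (hS : ∀ D : A[X], (∀ f ∈ S, D ∣ f) → D.natDegree = 0) {D : K[X]}
    (hD : ∀ f ∈ S, D ∣ f.map (algebraMap A K)) : D.natDegree = 0 := by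
  let : NormalizedGCDMonoid A := Nonempty.some inferInstance
  obtain ⟨N, hNprim, hND, hdeg⟩ := exists_isPrimitive_map_dvd (A := A) D
  rw [← hdeg]
  exact hS N fun f hf => hNprim.dvd_of_fraction_map_dvd_fraction_map (hND.trans (hD f hf))

theorem exists_C_mem_span_of_forall_dvd_natDegree_eq_zero [UniqueFactorizationMonoid A]
    {S : Set A[X]} (hS : ∀ D : A[X], (∀ f ∈ S, D ∣ f) → D.natDegree = 0) :
    ∃ a : A, a ≠ 0 ∧ C a ∈ Ideal.span S := by
  refine exists_C_mem_of_map_eq_top (K := FractionRing A) ?_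
  rw [Ideal.map_span]
  refine span_eq_top_of_forall_dvd_natDegree_eq_zero fun D hD => ?_
  exact natDegree_eq_zero_of_forall_dvd_map hS fun f hf => hD _ (Set.mem_image_of_mem _ hf)

end Elimination

section CommonDivisors

open MvPolynomial

/-- Every common divisor of the members of `S` is a constant (which may be a nonunit of `R`): the
coprimality hypothesis, over the ring of coefficients itself. -/
def CommonDivisorsConstant {σ R : Type*} [CommSemiring R] (S : Set (MvPolynomial σ R)) : Prop :=
  ∀ D : MvPolynomial σ R, (∀ f ∈ S, D ∣ f) → D.totalDegree = 0

/-- The coefficients of the members of `S`, viewed as polynomials in the first variable over the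
ring of polynomials in the others. -/
def coeffSet {r : ℕ} {R : Type*} [CommSemiring R] (S : Set (MvPolynomial (Fin (r + 1)) R)) :
    Set (MvPolynomial (Fin r) R) :=
  ⋃ f ∈ S, Set.range (finSuccEquiv R r f).coeff

section

variable {r : ℕ} {R : Type*} [CommSemiring R] {S : Set (MvPolynomial (Fin (r + 1)) R)}

theorem coeff_mem_coeffSet {f : MvPolynomial (Fin (r + 1)) R} (hf : f ∈ S)
    (k : ℕ) : (finSuccEquiv R r f).coeff k ∈ coeffSet S :=
  Set.mem_biUnion hf ⟨k, rfl⟩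

theorem coeffSet_finite (hS : S.Finite) : (coeffSet S).Finite := by
  refine hS.biUnion fun f _ => ?_
  set q := finSuccEquiv R r f
  refine ((q.support.finite_toSet.image q.coeff).insert 0).subset ?_
  rintro _ ⟨k, rfl⟩
  by_cases hk : q.coeff k = 0
  · exact Or.inl hk
  · exact Or.inr ⟨k, Polynomial.mem_support_iff.2 hk, rfl⟩

theorem exists_mem_coeffSet_ne_zero (hS : ∃ f ∈ S, f ≠ 0) : ∃ c ∈ coeffSet S, c ≠ 0 := by
  obtain ⟨f, hf, hf0⟩ := hS
  refine ⟨_, coeff_mem_coeffSet hf _, Polynomial.leadingCoeff_ne_zero.2 ?_⟩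
  exact (EmbeddingLike.map_ne_zero_iff (f := finSuccEquiv R r)).2 hf0

theorem finSuccEquiv_rename_succ (g : MvPolynomial (Fin r) R) :
    finSuccEquiv R r (rename Fin.succ g) = Polynomial.C g := by
  induction g using MvPolynomial.induction_on with
  | C a => rw [rename_C, finSuccEquiv_apply, coe_eval₂Hom, eval₂_C, RingHom.comp_apply]
  | add f g hf hg => simp only [map_add, hf, hg]
  | mul_X f i hf => simp only [map_mul, hf, rename_X, finSuccEquiv_X_succ]

theorem CommonDivisorsConstant.coeffSet (hS : CommonDivisorsConstant S) :
    CommonDivisorsConstant (coeffSet S) := by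
  intro D hD
  have hdvd : ∀ f ∈ S, rename Fin.succ D ∣ f := fun f hf => by
    rw [← map_dvd_iff (finSuccEquiv R r), finSuccEquiv_rename_succ,
      Polynomial.C_dvd_iff_dvd_coeff]
    exact fun k => hD _ (coeff_mem_coeffSet hf k)
  rcases eq_or_ne D 0 with rfl | hD0
  · exact totalDegree_zero
  have hcoeff : (finSuccEquiv R r (rename Fin.succ D)).coeff 0 = D := by
    rw [finSuccEquiv_rename_succ, Polynomial.coeff_C_zero]
  have hdeg := totalDegree_coeff_finSuccEquiv_add_le (rename Fin.succ D) 0 (hcoeff.symm ▸ hD0)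
  rw [hcoeff, hS _ hdvd] at hdeg
  exact Nat.le_zero.1 hdeg

end

theorem CommonDivisorsConstant.exists_rename_succ_mem_span {r : ℕ} {R : Type*} [CommRing R]
    [IsDomain R] [UniqueFactorizationMonoid R] {S : Set (MvPolynomial (Fin (r + 1)) R)}
    (hS : CommonDivisorsConstant S) :
    ∃ g : MvPolynomial (Fin r) R, g ≠ 0 ∧ rename Fin.succ g ∈ Ideal.span S := by
  set E := finSuccEquiv R r
  obtain ⟨g, hg0, hg⟩ := exists_C_mem_span_of_forall_dvd_natDegree_eq_zero (S := E '' S) <| by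
    intro D hD
    have hconst : (E.symm D).totalDegree = 0 := hS _ fun f hf => by
      simpa only [AlgEquiv.symm_apply_apply] using map_dvd E.symm (hD _ ⟨f, hf, rfl⟩)
    have hdeg := natDegree_finSuccEquiv (E.symm D)
    rw [E.apply_symm_apply] at hdeg
    exact hdeg.trans (Nat.le_zero.1 ((degreeOf_le_totalDegree _ _).trans_eq hconst))
  refine ⟨g, hg0, ?_⟩
  rw [← finSuccEquiv_rename_succ] at hg
  have hg' := Ideal.mem_map_of_mem E.symm.toRingHom hg
  rw [Ideal.map_span, Set.image_image] at hg'
  simpa [E] using hg'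

theorem CoprimePolys.commonDivisorsConstant {r s : ℕ} {P : Fin s → MvPolynomial (Fin r) ℤ}
    (hP : CoprimePolys P) : CommonDivisorsConstant (Set.range P) := by
  intro D hD
  by_contra hD0
  refine hP ⟨map (Int.castRingHom ℚ) D, ?_, fun i => map_dvd _ (hD _ ⟨i, rfl⟩)⟩
  have hdeg : (map (Int.castRingHom ℚ) D).totalDegree = D.totalDegree := by
    simp only [totalDegree, support_map_of_injective _ (RingHom.injective_int (Int.castRingHom ℚ))]
  rw [hdeg]
  exact Nat.pos_of_ne_zero hD0

end CommonDivisors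

section Proportion

/-- The proportion of the points of `s` that lie in `A` (and `0` if `s` is empty). With `s` a box,
`HasDensity A d` says that this proportion tends to `d`. -/
noncomputable def proportion {α : Type*} (s : Finset α) (A : Set α) : ℝ :=
  ((A ∩ s).ncard : ℝ) / s.card

variable {α ι : Type*} {s : Finset α} {A A' : Set α}

theorem proportion_eq_card_filter_div [DecidablePred (· ∈ A)] :
    proportion s A = ((s.filter (· ∈ A)).card : ℝ) / s.card := by
  rw [proportion, ← Set.ncard_coe_finset (s.filter _), Finset.coe_filter, Set.inter_comm]
  rfl

theorem proportion_nonneg : 0 ≤ proportion s A := by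
  unfold proportion
  positivity

theorem proportion_mono (h : ∀ x ∈ s, x ∈ A → x ∈ A') : proportion s A ≤ proportion s A' := by
  unfold proportion
  gcongr ((?_ : ℕ) : ℝ) / _
  exact Set.ncard_le_ncard (fun x hx => ⟨h x hx.2 hx.1, hx.2⟩) (s.finite_toSet.inter_of_right _)

theorem proportion_le_one : proportion s A ≤ 1 := by
  refine (proportion_mono fun _ _ _ => Set.mem_univ _).trans ?_
  rw [proportion, Set.univ_inter, Set.ncard_coe_finset]
  exact div_self_le_one _

theorem proportion_empty : proportion s ∅ = 0 := by
  simp only [proportion, Set.empty_inter, Set.ncard_empty, Nat.cast_zero, zero_div]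

theorem proportion_union_le : proportion s (A ∪ A') ≤ proportion s A + proportion s A' := by
  simp only [proportion, ← add_div, Set.union_inter_distrib_right]
  gcongr
  exact_mod_cast Set.ncard_union_le _ _

theorem proportion_biUnion_le (t : Finset ι) (A : ι → Set α) :
    proportion s (⋃ i ∈ t, A i) ≤ ∑ i ∈ t, proportion s (A i) := by
  classical
  induction t using Finset.induction_on with
  | empty => simp [proportion_empty]
  | insert i t hi ih =>
    rw [Finset.set_biUnion_insert, Finset.sum_insert hi]
    exact proportion_union_le.trans (by gcongr)

theorem proportion_preimage_finset {β : Type*} (φ : α → β) (T : Finset β) :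
    proportion s (φ ⁻¹' T) = ∑ t ∈ T, proportion s (φ ⁻¹' {t}) := by
  classical
  simp only [proportion_eq_card_filter_div, ← Finset.sum_div, ← Nat.cast_sum, Set.mem_preimage,
    Set.mem_singleton_iff, SetLike.mem_coe]
  congr 2
  have hmaps : ∀ x ∈ s.filter (φ · ∈ T), φ x ∈ T := fun x hx => (Finset.mem_filter.1 hx).2
  rw [Finset.card_eq_sum_card_fiberwise hmaps]
  refine Finset.sum_congr rfl fun t ht => ?_
  rw [Finset.filter_filter]
  congr 1 with x
  grind

theorem proportion_pi [Fintype ι] [DecidableEq ι] {α : ι → Type*} (s : ∀ i, Finset (α i))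
    (A : ∀ i, Set (α i)) :
    proportion (Fintype.piFinset s) (Set.univ.pi A) = ∏ i, proportion (s i) (A i) := by
  classical
  simp only [proportion_eq_card_filter_div, Finset.prod_div_distrib, ← Nat.cast_prod,
    ← Fintype.card_piFinset]
  congr 3
  ext x
  simp only [Finset.mem_filter, Fintype.mem_piFinset, Set.mem_univ_pi, forall_and]

end Proportion

section Box

theorem proportion_box_succ {r B : ℕ} (A : Set (Fin (r + 1) → ℤ)) :
    proportion (box (r + 1) B) A =
      (∑ a ∈ box r B, proportion (Finset.Ico 0 (B : ℤ)) {x | Fin.cons x a ∈ A}) /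
        (box r B).card := by
  classical
  have hcard : (box (r + 1) B).card = (Finset.Ico 0 (B : ℤ)).card * (box r B).card := by
    simp [box, Fintype.card_piFinset, pow_succ']
  simp only [proportion_eq_card_filter_div, ← Finset.sum_div, ← Nat.cast_sum, div_div, hcard,
    Nat.cast_mul]
  congr 2
  rw [Finset.card_eq_sum_card_fiberwise (f := Fin.tail) (t := box r B)]
  · refine Finset.sum_congr rfl fun a ha => ?_
    refine Finset.card_bij' (fun n _ => n 0) (fun x _ => Fin.cons x a) ?_ ?_ ?_ ?_
    · rintro n hn
      simp only [Finset.mem_filter, box, Fintype.mem_piFinset] at hn ⊢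
      exact ⟨hn.1.1 0, by simpa [← hn.2] using hn.1.2⟩
    · intro x hx
      simp only [Finset.mem_filter, box, Fintype.mem_piFinset, Fin.tail_cons] at hx ha ⊢
      exact ⟨⟨Fin.cases hx.1 ha, hx.2⟩, trivial⟩
    · rintro n hn
      rw [← (Finset.mem_filter.1 hn).2, Fin.cons_self_tail]
    · exact fun _ _ => rfl
  · intro n hn
    have hn' := Fintype.mem_piFinset.1 (Finset.mem_filter.1 hn).1
    exact Fintype.mem_piFinset.2 fun i => hn' i.succ

theorem proportion_box_succ_le {r B : ℕ} {A : Set (Fin r → ℤ)} {N : Set (Fin (r + 1) → ℤ)} {c : ℝ}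
    (hN : Set.MapsTo Fin.tail N A)
    (hline : ∀ a ∈ box r B, a ∈ A → proportion (Finset.Ico 0 (B : ℤ)) {x | Fin.cons x a ∈ N} ≤ c) :
    proportion (box (r + 1) B) N ≤ c * proportion (box r B) A := by
  classical
  rw [proportion_box_succ, proportion_eq_card_filter_div, ← mul_div_assoc]
  gcongr
  calc _ ≤ ∑ a ∈ box r B, if a ∈ A then c else 0 := by
        refine Finset.sum_le_sum fun a ha => ?_
        split_ifs with haA
        · exact hline a ha haA
        · have hempty : {x : ℤ | (Fin.cons x a : Fin (r + 1) → ℤ) ∈ N} = ∅ :=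
            Set.eq_empty_of_forall_notMem fun x hx => haA (by simpa using hN hx)
          rw [hempty, proportion_empty]
    _ = c * ((box r B).filter (· ∈ A)).card := by
        rw [← Finset.sum_filter, Finset.sum_const, nsmul_eq_mul, mul_comm]

theorem proportion_preimage_tail_le {r B : ℕ} (A : Set (Fin r → ℤ)) :
    proportion (box (r + 1) B) (Fin.tail ⁻¹' A) ≤ proportion (box r B) A :=
  (proportion_box_succ_le (Set.mapsTo_preimage _ _) fun _ _ _ => proportion_le_one).trans_eq
    (one_mul _)

end Box

section Residues

/-- Reduction of an integer point modulo `m`. -/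
def reduceMod {σ : Type*} (m : ℕ) (n : σ → ℤ) : σ → ZMod m := fun i => (n i : ZMod m)

theorem abs_card_filter_intCast_eq_sub_le (m : ℕ) [NeZero m] (B : ℕ) (t : ZMod m) :
    |(((Finset.Ico 0 (B : ℤ)).filter (fun x : ℤ => (x : ZMod m) = t)).card : ℚ) - B / m| ≤ 1 := by
  have hm : (0 : ℚ) < m := by exact_mod_cast NeZero.pos m
  have hmod (x : ℤ) : (x : ZMod m) = t ↔ x ≡ t.val [ZMOD m] := by
    rw [← ZMod.intCast_eq_intCast_iff, Int.cast_natCast, ZMod.natCast_zmod_val]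
  have hceil := Int.Ico_filter_modEq_card 0 (B : ℤ) (r := (m : ℤ)) (by exact_mod_cast hm) t.val
  simp only [hmod, ← Int.cast_natCast (R := ℚ) (Finset.card _), hceil]
  push_cast
  have hsplit : ((B : ℚ) - t.val) / m - (0 - t.val) / m = B / m := by ring
  have hBm : (0 : ℚ) ≤ B / m := by positivity
  generalize ((B : ℚ) - t.val) / m = x at *
  generalize ((0 : ℚ) - t.val) / m = y at *
  have hx := Int.ceil_lt_add_one x
  have hy := Int.ceil_lt_add_one y
  have hx' := Int.le_ceil x
  have hy' := Int.le_ceil y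
  rw [abs_le]
  constructor
  · linarith [le_max_left ((⌈x⌉ : ℚ) - ⌈y⌉) 0]
  · rw [sub_le_iff_le_add]
    exact max_le (by linarith) (by linarith)

theorem abs_proportion_residue_sub_le (m : ℕ) [NeZero m] {B : ℕ} (hB : 0 < B) (t : ZMod m) :
    |proportion (Finset.Ico 0 (B : ℤ)) (Int.cast ⁻¹' {t}) - 1 / m| ≤ 1 / B := by
  classical
  have hB' : (0 : ℝ) < B := by exact_mod_cast hB
  have hm : (m : ℝ) ≠ 0 := by exact_mod_cast NeZero.ne m
  have hcount := (Rat.cast_le (K := ℝ)).2 (abs_card_filter_intCast_eq_sub_le m B t)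
  push_cast at hcount
  simp only [proportion_eq_card_filter_div, Int.card_Ico, sub_zero, Int.toNat_natCast,
    Set.mem_preimage, Set.mem_singleton_iff]
  set c := ((Finset.Ico 0 (B : ℤ)).filter (fun x : ℤ => (x : ZMod m) = t)).card
  have hdiv : (c : ℝ) / B - 1 / m = (c - B / m) / B := by field_simp
  rw [hdiv, abs_div, abs_of_pos hB']
  gcongr

theorem proportion_reduceMod_mem (m : ℕ) {r : ℕ} (B : ℕ) (T : Finset (Fin r → ZMod m)) :
    proportion (box r B) (reduceMod m ⁻¹' T) =
      ∑ t ∈ T, ∏ i, proportion (Finset.Ico 0 (B : ℤ)) (Int.cast ⁻¹' {t i}) := by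
  rw [proportion_preimage_finset]
  refine Finset.sum_congr rfl fun t _ => ?_
  rw [box, ← proportion_pi]
  congr 1
  ext n
  simp [reduceMod, funext_iff]

theorem hasDensity_reduceMod (m : ℕ) [NeZero m] {r : ℕ} (T : Finset (Fin r → ZMod m)) :
    HasDensity (reduceMod m ⁻¹' (T : Set (Fin r → ZMod m))) ((T.card : ℝ) / (m : ℝ) ^ r) := by
  have hres (t : ZMod m) : Tendsto
      (fun B : ℕ => proportion (Finset.Ico 0 (B : ℤ)) (Int.cast ⁻¹' {t})) atTop (𝓝 (1 / m)) := by
    rw [tendsto_iff_dist_tendsto_zero]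
    refine squeeze_zero' (Eventually.of_forall fun _ => dist_nonneg) ?_
      tendsto_one_div_atTop_nhds_zero_nat
    filter_upwards [eventually_gt_atTop 0] with B hB
    exact abs_proportion_residue_sub_le m hB t
  have hsum := tendsto_finsetSum T fun t _ => tendsto_finsetProd Finset.univ fun i _ => hres (t i)
  simp only [← proportion_reduceMod_mem] at hsum
  simpa [HasDensity, proportion, div_eq_mul_inv] using hsum

theorem proportion_reduceMod_le {m : ℕ} [NeZero m] {r B : ℕ} (hmB : m ≤ B)
    (T : Finset (Fin r → ZMod m)) :
    proportion (box r B) (reduceMod m ⁻¹' T) ≤ T.card * (2 / m) ^ r := by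
  have hm : (0 : ℝ) < m := by exact_mod_cast NeZero.pos m
  have hres (t : ZMod m) : proportion (Finset.Ico 0 (B : ℤ)) (Int.cast ⁻¹' {t}) ≤ 2 / m := by
    have hdiff := (abs_le.1 (abs_proportion_residue_sub_le m ((NeZero.pos m).trans_le hmB) t)).2
    have hinv : (1 : ℝ) / B ≤ 1 / m := by gcongr
    linarith [add_div (1 : ℝ) 1 m, one_add_one_eq_two (R := ℝ)]
  rw [proportion_reduceMod_mem, ← nsmul_eq_mul]
  refine Finset.sum_le_card_nsmul _ _ _ fun t _ => ?_
  calc _ ≤ ∏ _i : Fin r, (2 / m : ℝ) :=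
        Finset.prod_le_prod (fun _ _ => proportion_nonneg) fun i _ => hres (t i)
    _ = _ := by rw [Finset.prod_const, Finset.card_univ, Fintype.card_fin]

end Residues

section Zeros

open MvPolynomial

theorem proportion_eval_eq_zero_le {r : ℕ} {R : Type*} [CommRing R] [IsDomain R]
    {p : MvPolynomial (Fin r) R} (hp : p ≠ 0) (s : Finset R) :
    proportion (Fintype.piFinset fun _ => s) {x | eval x p = 0} ≤ p.totalDegree / s.card := by
  classical
  have h := (NNRat.cast_le (K := ℝ)).2 (schwartz_zippel_totalDegree hp s)
  push_cast at h
  simpa [proportion_eq_card_filter_div, Fintype.card_piFinset] using h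

theorem exists_map_intCast_ne_zero {σ : Type*} {g : MvPolynomial σ ℤ} (hg : g ≠ 0) :
    ∃ M : ℕ, ∀ p : ℕ, M < p → map (Int.castRingHom (ZMod p)) g ≠ 0 := by
  obtain ⟨m, hm⟩ := ne_zero_iff.1 hg
  refine ⟨(g.coeff m).natAbs, fun p hp h => hm ?_⟩
  have hcoeff : ((g.coeff m : ℤ) : ZMod p) = 0 := by
    simpa [coeff_map] using congrArg (coeff m) h
  rw [ZMod.intCast_zmod_eq_zero_iff_dvd, Int.natCast_dvd] at hcoeff
  exact Int.natAbs_eq_zero.1 (Nat.eq_zero_of_dvd_of_lt hcoeff hp)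

theorem eval_reduceMod_eq_zero_iff {σ : Type*} {m : ℕ} {n : σ → ℤ} {f : MvPolynomial σ ℤ} :
    eval (reduceMod m n) (map (Int.castRingHom (ZMod m)) f) = 0 ↔ (m : ℤ) ∣ eval n f := by
  have hcast : ((eval n f : ℤ) : ZMod m) = eval₂ (Int.castRingHom (ZMod m)) (reduceMod m n) f :=
    eval₂_comp_left (Int.castRingHom (ZMod m)) (RingHom.id ℤ) n f
  rw [eval_map, ← hcast, ZMod.intCast_zmod_eq_zero_iff_dvd]

theorem proportion_dvd_eval_le {r : ℕ} {g : MvPolynomial (Fin r) ℤ} {p B : ℕ} [Fact p.Prime]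
    (hpB : p ≤ B) (hg : map (Int.castRingHom (ZMod p)) g ≠ 0) :
    proportion (box r B) {n | (p : ℤ) ∣ eval n g} ≤ g.totalDegree * 2 ^ r / p := by
  classical
  set G := map (Int.castRingHom (ZMod p)) g
  set T : Finset (Fin r → ZMod p) := Finset.univ.filter fun x => eval x G = 0
  have hp : (0 : ℝ) < p := by exact_mod_cast (Fact.out : p.Prime).pos
  have hT : (T.card : ℝ) ≤ g.totalDegree / p * (p : ℝ) ^ r := by
    have hzeros := proportion_eval_eq_zero_le hg Finset.univ
    rw [proportion_eq_card_filter_div, Fintype.piFinset_univ, Finset.card_univ, Finset.card_univ,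
      Fintype.card_fun, ZMod.card, Fintype.card_fin, Nat.cast_pow, div_le_iff₀ (by positivity)]
      at hzeros
    refine hzeros.trans ?_
    gcongr
    exact Finset.sup_mono (support_map_subset _ g)
  have hpre : {n | (p : ℤ) ∣ eval n g} = reduceMod p ⁻¹' (T : Set (Fin r → ZMod p)) := by
    ext n
    simp [T, G, ← eval_reduceMod_eq_zero_iff]
  calc proportion (box r B) {n | (p : ℤ) ∣ eval n g} ≤ T.card * (2 / p) ^ r := by
        rw [hpre]
        exact proportion_reduceMod_le hpB T
    _ ≤ g.totalDegree / p * (p : ℝ) ^ r * (2 / p) ^ r := by gcongr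
    _ = g.totalDegree * 2 ^ r / p := by
        rw [div_pow]
        field_simp

theorem exists_abs_eval_le {r : ℕ} (g : MvPolynomial (Fin r) ℤ) :
    ∃ e : ℕ, ∀ B : ℕ, 2 ≤ B → ∀ n ∈ box r B, |eval n g| ≤ (B : ℤ) ^ e := by
  induction g using MvPolynomial.induction_on with
  | C a =>
    refine ⟨a.natAbs, fun B hB n _ => ?_⟩
    rw [eval_C, Int.abs_eq_natAbs]
    exact_mod_cast (Nat.lt_pow_self hB).le
  | add f g hf hg =>
    obtain ⟨e, hf⟩ := hf
    obtain ⟨e', hg⟩ := hg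
    refine ⟨max e e' + 1, fun B hB n hn => ?_⟩
    have hB2 : (2 : ℤ) ≤ B := by exact_mod_cast hB
    have hB1 : (1 : ℤ) ≤ B := by linarith
    calc |eval n (f + g)| ≤ |eval n f| + |eval n g| := by
          rw [map_add]
          exact abs_add_le _ _
      _ ≤ (B : ℤ) ^ max e e' + (B : ℤ) ^ max e e' :=
        add_le_add ((hf B hB n hn).trans (pow_le_pow_right₀ hB1 (le_max_left _ _)))
          ((hg B hB n hn).trans (pow_le_pow_right₀ hB1 (le_max_right _ _)))
      _ = (B : ℤ) ^ max e e' * 2 := (mul_two _).symm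
      _ ≤ (B : ℤ) ^ (max e e' + 1) := by
        rw [pow_succ]
        gcongr
  | mul_X f i hf =>
    obtain ⟨e, hf⟩ := hf
    refine ⟨e + 1, fun B hB n hn => ?_⟩
    have hni := Finset.mem_Ico.1 (Fintype.mem_piFinset.1 hn i)
    rw [map_mul, eval_X, abs_mul, pow_succ, abs_of_nonneg hni.1]
    exact mul_le_mul (hf B hB n hn) hni.2.le hni.1 (by positivity)

theorem card_primeFactors_gt_le {B e N : ℕ} (hB : 1 < B) (hN : N ≠ 0) (hNB : N ≤ B ^ e) :
    (N.primeFactors.filter (B < ·)).card ≤ e := by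
  have hprod : ∏ p ∈ N.primeFactors.filter (B < ·), p ≤ N :=
    Nat.le_of_dvd (Nat.pos_of_ne_zero hN) <|
      (Finset.prod_dvd_prod_of_subset _ _ _ (Finset.filter_subset _ _)).trans
        (Nat.prod_primeFactors_dvd N)
  have hpow : B ^ (N.primeFactors.filter (B < ·)).card ≤ N :=
    (Finset.pow_card_le_prod _ _ _ fun p hp => (Finset.mem_filter.1 hp).2.le).trans hprod
  exact (Nat.pow_le_pow_iff_right hB).1 (hpow.trans hNB)

theorem proportion_polynomial_eval_eq_zero_le {p B : ℕ} [Fact p.Prime] (hB : 0 < B)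
    {Q : Polynomial (ZMod p)} (hQ : Q ≠ 0) :
    proportion (Finset.Ico 0 (B : ℤ)) {x | Q.eval (x : ZMod p) = 0} ≤
      Q.natDegree * (1 / p + 1 / B) := by
  classical
  have hroots : {x : ℤ | Q.eval (x : ZMod p) = 0} =
      Int.cast ⁻¹' (Q.roots.toFinset : Set (ZMod p)) := by
    ext x
    simp [hQ]
  rw [hroots, proportion_preimage_finset]
  calc _ ≤ Q.roots.toFinset.card • (1 / p + 1 / B : ℝ) := by
        refine Finset.sum_le_card_nsmul _ _ _ fun t _ => ?_
        exact sub_le_iff_le_add'.1 (abs_le.1 (abs_proportion_residue_sub_le p hB t)).2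
    _ ≤ _ := by
        rw [nsmul_eq_mul]
        gcongr
        exact (Multiset.toFinset_card_le _).trans Q.card_roots'

/-- The integer points at which all members of `S` vanish modulo `m`. -/
def zerosMod {σ : Type*} (S : Set (MvPolynomial σ ℤ)) (m : ℕ) : Set (σ → ℤ) :=
  {n | ∀ f ∈ S, (m : ℤ) ∣ eval n f}

theorem dvd_eval_of_mem_span {σ : Type*} {S : Set (MvPolynomial σ ℤ)} {g : MvPolynomial σ ℤ}
    (hg : g ∈ Ideal.span S) {m : ℕ} {n : σ → ℤ} (hn : n ∈ zerosMod S m) : (m : ℤ) ∣ eval n g := by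
  have hle : Ideal.span S ≤ (Ideal.span {(m : ℤ)}).comap (eval n) :=
    Ideal.span_le.2 fun f hf => Ideal.mem_span_singleton.2 (hn f hf)
  exact Ideal.mem_span_singleton.1 (hle hg)

theorem proportion_line_zerosMod_le {r : ℕ} {S : Set (MvPolynomial (Fin (r + 1)) ℤ)} {d : ℕ}
    (hd : ∀ f ∈ S, f.degreeOf 0 ≤ d) {p B : ℕ} [Fact p.Prime] (hB : 0 < B) {a : Fin r → ℤ}
    (ha : a ∉ zerosMod (coeffSet S) p) :
    proportion (Finset.Ico 0 (B : ℤ)) {x | Fin.cons x a ∈ zerosMod S p} ≤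
      d * (1 / p + 1 / B) := by
  obtain ⟨f, hf, k, hk⟩ : ∃ f ∈ S, ∃ k, ¬ (p : ℤ) ∣ eval a ((finSuccEquiv ℤ r f).coeff k) := by
    simpa [zerosMod, coeffSet] using ha
  set q : Polynomial ℤ := (finSuccEquiv ℤ r f).map (eval a)
  set Q : Polynomial (ZMod p) := q.map (Int.castRingHom (ZMod p))
  have hQ0 : Q ≠ 0 := fun h => hk <| by
    have hcoeff := congrArg (Polynomial.coeff · k) h
    simpa only [Q, q, Polynomial.coeff_map, Polynomial.coeff_zero, Int.coe_castRingHom,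
      ZMod.intCast_zmod_eq_zero_iff_dvd] using hcoeff
  have hdeg : Q.natDegree ≤ d :=
    (Polynomial.natDegree_map_le.trans Polynomial.natDegree_map_le).trans
      ((natDegree_finSuccEquiv f).le.trans (hd f hf))
  calc proportion (Finset.Ico 0 (B : ℤ)) {x | Fin.cons x a ∈ zerosMod S p} ≤
      proportion (Finset.Ico 0 (B : ℤ)) {x | Q.eval (x : ZMod p) = 0} := by
        refine proportion_mono fun x _ hx => ?_
        have hdvd := hx f hf
        rw [eval_eq_eval_mv_eval', ← ZMod.intCast_zmod_eq_zero_iff_dvd] at hdvd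
        exact (Polynomial.eval_map_apply (f := Int.castRingHom (ZMod p)) x).trans hdvd
    _ ≤ Q.natDegree * (1 / p + 1 / B) := proportion_polynomial_eval_eq_zero_le hB hQ0
    _ ≤ d * (1 / p + 1 / B) := by gcongr

end Zeros

section LargePrimes

open MvPolynomial

/-- The integer points at which all members of `S` are divisible by a common prime `p > M`. -/
def largePrimeZeros {σ : Type*} (S : Set (MvPolynomial σ ℤ)) (M : ℕ) : Set (σ → ℤ) :=
  {n | ∃ p : ℕ, p.Prime ∧ M < p ∧ n ∈ zerosMod S p}

/-- The conclusion of Ekedahl's sieve: the upper density of the points at which a prime `p > M`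
divides all values tends to `0` as `M` tends to infinity. -/
def NegligibleLargePrimes {r : ℕ} (S : Set (MvPolynomial (Fin r) ℤ)) : Prop :=
  ∀ ε : ℝ, 0 < ε → ∀ᶠ M : ℕ in atTop, ∀ᶠ B : ℕ in atTop,
    proportion (box r B) (largePrimeZeros S M) ≤ ε

/-- The zeros of `S` modulo `p` at which the line through the point, in the direction of the first
coordinate, does not consist of zeros of `S` modulo `p` for the trivial reason that all coefficients
with respect to that coordinate vanish. -/
def transverseZeros {r : ℕ} (S : Set (MvPolynomial (Fin (r + 1)) ℤ)) (p : ℕ) :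
    Set (Fin (r + 1) → ℤ) :=
  zerosMod S p \ Fin.tail ⁻¹' zerosMod (coeffSet S) p

variable {r : ℕ} {S : Set (MvPolynomial (Fin (r + 1)) ℤ)} {d : ℕ} {g : MvPolynomial (Fin r) ℤ}

theorem dvd_eval_tail_of_mem_zerosMod (hgS : rename Fin.succ g ∈ Ideal.span S) {m : ℕ}
    {n : Fin (r + 1) → ℤ} (hn : n ∈ zerosMod S m) : (m : ℤ) ∣ eval (Fin.tail n) g := by
  have hdvd := dvd_eval_of_mem_span hgS hn
  rwa [eval_rename] at hdvd

theorem proportion_line_transverseZeros_le (hd : ∀ f ∈ S, f.degreeOf 0 ≤ d) {p B : ℕ}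
    (hp : p.Prime) (hB : 0 < B) (a : Fin r → ℤ) :
    proportion (Finset.Ico 0 (B : ℤ)) {x | Fin.cons x a ∈ transverseZeros S p} ≤
      d * (1 / p + 1 / B) := by
  have := Fact.mk hp
  by_cases ha : a ∈ zerosMod (coeffSet S) p
  · have hempty : {x : ℤ | (Fin.cons x a : Fin (r + 1) → ℤ) ∈ transverseZeros S p} = ∅ :=
      Set.eq_empty_of_forall_notMem fun x hx => hx.2 ha
    rw [hempty, proportion_empty]
    positivity
  · exact (proportion_mono fun x _ hx => hx.1).trans (proportion_line_zerosMod_le hd hB ha)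

theorem proportion_transverseZeros_le (hd : ∀ f ∈ S, f.degreeOf 0 ≤ d)
    (hgS : rename Fin.succ g ∈ Ideal.span S) {p B : ℕ} (hp : p.Prime) (hpB : p ≤ B)
    (hgp : map (Int.castRingHom (ZMod p)) g ≠ 0) :
    proportion (box (r + 1) B) (transverseZeros S p) ≤
      2 * d * (g.totalDegree * 2 ^ r) * ((p : ℝ) ^ 2)⁻¹ := by
  have := Fact.mk hp
  have hp0 : (0 : ℝ) < p := by exact_mod_cast hp.pos
  have hinv : (1 : ℝ) / B ≤ 1 / p := by gcongr
  calc proportion (box (r + 1) B) (transverseZeros S p)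
      ≤ d * (1 / p + 1 / B) * proportion (box r B) {a | (p : ℤ) ∣ eval a g} :=
        proportion_box_succ_le (fun n hn => dvd_eval_tail_of_mem_zerosMod hgS hn.1)
          fun a _ _ => proportion_line_transverseZeros_le hd hp (hp.pos.trans_le hpB) a
    _ ≤ d * (1 / p + 1 / p) * (g.totalDegree * 2 ^ r / p) := by
        gcongr
        · exact proportion_nonneg
        · exact proportion_dvd_eval_le hpB hgp
    _ = 2 * d * (g.totalDegree * 2 ^ r) * ((p : ℝ) ^ 2)⁻¹ := by
        field_simp
        ring

theorem proportion_line_exists_transverseZeros_le (hd : ∀ f ∈ S, f.degreeOf 0 ≤ d)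
    (hgS : rename Fin.succ g ∈ Ideal.span S) {B e : ℕ} (hB : 2 ≤ B) {a : Fin r → ℤ}
    (hga : eval a g ≠ 0) (he : |eval a g| ≤ (B : ℤ) ^ e) :
    proportion (Finset.Ico 0 (B : ℤ))
      {x | ∃ p : ℕ, p.Prime ∧ B < p ∧ Fin.cons x a ∈ transverseZeros S p} ≤ 2 * d * e / B := by
  set F := (eval a g).natAbs.primeFactors.filter (B < ·)
  have hF : F.card ≤ e := by
    refine card_primeFactors_gt_le hB (Int.natAbs_ne_zero.2 hga) ?_
    zify
    exact he
  have hcover : {x | ∃ p : ℕ, p.Prime ∧ B < p ∧ Fin.cons x a ∈ transverseZeros S p} ⊆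
      ⋃ p ∈ F, {x : ℤ | (Fin.cons x a : Fin (r + 1) → ℤ) ∈ transverseZeros S p} := by
    rintro x ⟨p, hp, hBp, hx⟩
    have hpg := dvd_eval_tail_of_mem_zerosMod hgS hx.1
    rw [Fin.tail_cons, Int.natCast_dvd] at hpg
    have hpF : p ∈ F := Finset.mem_filter.2
      ⟨Nat.mem_primeFactors.2 ⟨hp, hpg, Int.natAbs_ne_zero.2 hga⟩, hBp⟩
    exact Set.mem_biUnion hpF hx
  calc _ ≤ ∑ p ∈ F, proportion (Finset.Ico 0 (B : ℤ)) {x | Fin.cons x a ∈ transverseZeros S p} :=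
        (proportion_mono fun x _ hx => hcover hx).trans (proportion_biUnion_le F _)
    _ ≤ F.card • (d * (1 / B + 1 / B) : ℝ) := by
        refine Finset.sum_le_card_nsmul _ _ _ fun p hp => ?_
        obtain ⟨hpF, hBp⟩ := Finset.mem_filter.1 hp
        refine (proportion_line_transverseZeros_le hd (Nat.prime_of_mem_primeFactors hpF)
          (by omega) a).trans ?_
        gcongr
    _ ≤ e * (d * (1 / B + 1 / B) : ℝ) := by
        rw [nsmul_eq_mul]
        gcongr
    _ = 2 * d * e / B := by ring

theorem exists_proportion_exists_transverseZeros_le (hd : ∀ f ∈ S, f.degreeOf 0 ≤ d)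
    (hgS : rename Fin.succ g ∈ Ideal.span S) :
    ∃ e : ℕ, ∀ B : ℕ, 2 ≤ B → proportion (box (r + 1) B)
      {n | eval (Fin.tail n) g ≠ 0 ∧ ∃ p : ℕ, p.Prime ∧ B < p ∧ n ∈ transverseZeros S p} ≤
        2 * d * e / B := by
  obtain ⟨e, he⟩ := exists_abs_eval_le g
  refine ⟨e, fun B hB => ?_⟩
  refine (proportion_box_succ_le (A := {a | eval a g ≠ 0}) (fun n hn => hn.1) ?_).trans
    (mul_le_of_le_one_right (by positivity) proportion_le_one)
  intro a ha hga
  exact (proportion_mono fun x _ hx => hx.2).trans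
    (proportion_line_exists_transverseZeros_le hd hgS hB hga (he B hB a ha))

theorem largePrimeZeros_subset (S : Set (MvPolynomial (Fin (r + 1)) ℤ))
    (g : MvPolynomial (Fin r) ℤ) (M B : ℕ) :
    largePrimeZeros S M ⊆
      Fin.tail ⁻¹' largePrimeZeros (coeffSet S) M ∪ Fin.tail ⁻¹' {a | eval a g = 0} ∪
        (⋃ p ∈ (Finset.Ioc M B).filter Nat.Prime, transverseZeros S p) ∪
        {n | eval (Fin.tail n) g ≠ 0 ∧ ∃ p : ℕ, p.Prime ∧ B < p ∧ n ∈ transverseZeros S p} := by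
  rintro n ⟨p, hp, hMp, hn⟩
  by_cases hcoeff : Fin.tail n ∈ zerosMod (coeffSet S) p
  · exact Or.inl (Or.inl (Or.inl ⟨p, hp, hMp, hcoeff⟩))
  by_cases hg : eval (Fin.tail n) g = 0
  · exact Or.inl (Or.inl (Or.inr hg))
  rcases le_or_gt p B with hpB | hBp
  · exact Or.inl (Or.inr (Set.mem_biUnion
      (Finset.mem_filter.2 ⟨Finset.mem_Ioc.2 ⟨hMp, hpB⟩, hp⟩) ⟨hn, hcoeff⟩))
  · exact Or.inr ⟨hg, p, hp, hBp, hn, hcoeff⟩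

theorem sum_primes_inv_sq_le (M B : ℕ) :
    ∑ p ∈ (Finset.Ioc M B).filter Nat.Prime, ((p : ℝ) ^ 2)⁻¹ ≤ 2 / (M + 1) := by
  refine le_trans (Finset.sum_le_sum_of_subset_of_nonneg ?_ fun _ _ _ => by positivity)
    (sum_Ioo_inv_sq_le M (B + 1))
  intro p hp
  rw [Finset.mem_filter, Finset.mem_Ioc] at hp
  exact Finset.mem_Ioo.2 ⟨hp.1.1, Nat.lt_succ_of_le hp.1.2⟩

theorem exists_proportion_largePrimeZeros_le (hS : S.Finite) (hg : g ≠ 0)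
    (hgS : rename Fin.succ g ∈ Ideal.span S) :
    ∃ K L : ℝ, ∀ᶠ M : ℕ in atTop, ∀ᶠ B : ℕ in atTop,
      proportion (box (r + 1) B) (largePrimeZeros S M) ≤
        proportion (box r B) (largePrimeZeros (coeffSet S) M) + K / (M + 1) + L / B := by
  obtain ⟨d, hd⟩ := (hS.image (degreeOf 0)).bddAbove
  replace hd : ∀ f ∈ S, f.degreeOf 0 ≤ d := fun f hf => hd ⟨f, hf, rfl⟩
  obtain ⟨e, he⟩ := exists_proportion_exists_transverseZeros_le hd hgS
  obtain ⟨M₀, hM₀⟩ := exists_map_intCast_ne_zero hg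
  set K : ℝ := 2 * d * (g.totalDegree * 2 ^ r)
  refine ⟨K * 2, g.totalDegree + 2 * d * e, ?_⟩
  filter_upwards [eventually_ge_atTop M₀] with M hM
  filter_upwards [eventually_ge_atTop 2] with B hB
  have hzero : proportion (box r B) {a | eval a g = 0} ≤ g.totalDegree / B := by
    simpa [box] using proportion_eval_eq_zero_le hg (Finset.Ico 0 (B : ℤ))
  have hmedium : ∑ p ∈ (Finset.Ioc M B).filter Nat.Prime,
      proportion (box (r + 1) B) (transverseZeros S p) ≤ K * 2 / (M + 1) := by
    rw [mul_div_assoc]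
    refine (Finset.sum_le_sum fun p hp => ?_).trans ((Finset.mul_sum _ _ _).symm.trans_le
      (mul_le_mul_of_nonneg_left (sum_primes_inv_sq_le M B) (by positivity)))
    obtain ⟨hpIoc, hp⟩ := Finset.mem_filter.1 hp
    obtain ⟨hMp, hpB⟩ := Finset.mem_Ioc.1 hpIoc
    exact proportion_transverseZeros_le hd hgS hp hpB (hM₀ p (hM.trans_lt hMp))
  calc proportion (box (r + 1) B) (largePrimeZeros S M)
      ≤ proportion (box r B) (largePrimeZeros (coeffSet S) M) + g.totalDegree / B +
          K * 2 / (M + 1) + 2 * d * e / B := by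
        refine (proportion_mono fun n _ hn => largePrimeZeros_subset S g M B hn).trans ?_
        refine proportion_union_le.trans (add_le_add ?_ (he B hB))
        refine proportion_union_le.trans (add_le_add ?_
          ((proportion_biUnion_le _ _).trans hmedium))
        exact proportion_union_le.trans (add_le_add (proportion_preimage_tail_le _)
          ((proportion_preimage_tail_le _).trans hzero))
    _ = _ := by ring

theorem NegligibleLargePrimes.of_coeffSet (hS : S.Finite) (hg : g ≠ 0)
    (hgS : rename Fin.succ g ∈ Ideal.span S) (hcoeff : NegligibleLargePrimes (coeffSet S)) :
    NegligibleLargePrimes S := by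
  intro ε hε
  obtain ⟨K, L, hKL⟩ := exists_proportion_largePrimeZeros_le hS hg hgS
  have hK : Tendsto (fun M : ℕ => K / ((M : ℝ) + 1)) atTop (𝓝 0) :=
    tendsto_const_nhds.div_atTop (tendsto_natCast_atTop_atTop.atTop_add tendsto_const_nhds)
  have hL := tendsto_const_div_atTop_nhds_zero_nat L
  have hε3 : 0 < ε / 3 := by positivity
  filter_upwards [hKL, hcoeff _ hε3, hK.eventually_le_const hε3] with M hKLM hcoeffM hKM
  filter_upwards [hKLM, hcoeffM, hL.eventually_le_const hε3] with B hB hcoeffB hLB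
  linarith

theorem negligibleLargePrimes_of_C_mem {r : ℕ} {S : Set (MvPolynomial (Fin r) ℤ)} {c : ℤ}
    (hc : c ≠ 0) (hcS : C c ∈ S) : NegligibleLargePrimes S := by
  intro ε hε
  filter_upwards [eventually_ge_atTop c.natAbs] with M hM
  have hempty : largePrimeZeros S M = ∅ := by
    refine Set.eq_empty_of_forall_notMem ?_
    rintro n ⟨p, -, hMp, hn⟩
    have hdvd := hn _ hcS
    rw [eval_C, Int.natCast_dvd] at hdvd
    exact hc (Int.natAbs_eq_zero.1 (Nat.eq_zero_of_dvd_of_lt hdvd (hM.trans_lt hMp)))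
  simp only [hempty, proportion_empty, hε.le, eventually_true]

theorem CommonDivisorsConstant.negligibleLargePrimes {r : ℕ} {S : Set (MvPolynomial (Fin r) ℤ)}
    (hcop : CommonDivisorsConstant S) (hS : S.Finite) (hS0 : ∃ f ∈ S, f ≠ 0) :
    NegligibleLargePrimes S := by
  induction r with
  | zero =>
    obtain ⟨f, hf, hf0⟩ := hS0
    rw [f.eq_C_of_isEmpty] at hf hf0
    exact negligibleLargePrimes_of_C_mem (fun h => hf0 (by rw [h, C_0])) hf
  | succ r ih =>
    obtain ⟨g, hg, hgS⟩ := hcop.exists_rename_succ_mem_span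
    exact .of_coeffSet hS hg hgS
      (ih hcop.coeffSet (coeffSet_finite hS) (exists_mem_coeffSet_ne_zero hS0))

end LargePrimes

section Sieve

open MvPolynomial

theorem hasDensity_pi_reduceMod {ι : Type*} [Fintype ι] {r : ℕ} (m : ι → ℕ) [∀ i, NeZero (m i)]
    (hm : Pairwise (Function.onFun Nat.Coprime m)) (T : ∀ i, Finset (Fin r → ZMod (m i))) :
    HasDensity {n | ∀ i, reduceMod (m i) n ∈ T i} (∏ i, ((T i).card : ℝ) / (m i : ℝ) ^ r) := by
  classical
  have : NeZero (∏ i, m i) := ⟨Finset.prod_ne_zero_iff.2 fun i _ => NeZero.ne (m i)⟩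
  let crt : (Fin r → ZMod (∏ i, m i)) ≃ (∀ i, Fin r → ZMod (m i)) :=
    ((Equiv.refl _).arrowCongr (ZMod.prodEquivPi m hm).toEquiv).trans (Equiv.piComm _)
  have hcrt (n : Fin r → ℤ) : crt (reduceMod _ n) = fun i => reduceMod (m i) n := by
    funext i j
    exact congrFun (map_intCast (ZMod.prodEquivPi m hm) (n j)) i
  have hset : {n : Fin r → ℤ | ∀ i, reduceMod (m i) n ∈ T i} =
      reduceMod (∏ i, m i) ⁻¹' ((Fintype.piFinset T).map crt.symm.toEmbedding : Finset _) := by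
    ext n
    simp [hcrt]
  rw [hset]
  convert hasDensity_reduceMod (∏ i, m i) ((Fintype.piFinset T).map crt.symm.toEmbedding) using 1
  rw [Finset.card_map, Fintype.card_piFinset, Finset.prod_div_distrib, Nat.cast_prod,
    Nat.cast_prod, Finset.prod_pow]

theorem HasDensity.le_add_of_subset_union {r : ℕ} {A A' Z : Set (Fin r → ℤ)} {d d' ε : ℝ}
    (hA : HasDensity A d) (hA' : HasDensity A' d') (hsub : A ⊆ A' ∪ Z)
    (hZ : ∀ᶠ B : ℕ in atTop, proportion (box r B) Z ≤ ε) : d ≤ d' + ε := by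
  refine le_of_tendsto_of_tendsto hA (hA'.add_const ε) ?_
  filter_upwards [hZ] with B hB
  exact ((proportion_mono fun n _ hn => hsub hn).trans proportion_union_le).trans
    (add_le_add le_rfl hB)

theorem summable_of_le_prod_one_sub {ι : Type*} {a : ι → ℝ} {c : ℝ} (t : Finset ι)
    (ha0 : ∀ i, 0 ≤ a i) (ha1 : ∀ i, a i ≤ 1) (hc : 0 < c)
    (hprod : ∀ F : Finset ι, Disjoint F t → c ≤ ∏ i ∈ F, (1 - a i)) : Summable a := by
  classical
  refine summable_of_sum_le (c := ∑ i ∈ t, a i - Real.log c) ha0 fun F => ?_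
  have hexp : c ≤ Real.exp (-∑ i ∈ F \ t, a i) := by
    rw [← Finset.sum_neg_distrib, Real.exp_sum]
    exact (hprod _ Finset.sdiff_disjoint).trans (Finset.prod_le_prod
      (fun i _ => sub_nonneg.2 (ha1 i)) fun i _ => Real.one_sub_le_exp_neg _)
  have hinter : ∑ i ∈ F ∩ t, a i ≤ ∑ i ∈ t, a i :=
    Finset.sum_le_sum_of_subset_of_nonneg Finset.inter_subset_right fun i _ _ => ha0 i
  have hlog : Real.log c ≤ -∑ i ∈ F \ t, a i := (Real.log_le_iff_le_exp hc).2 hexp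
  linarith [Finset.sum_inter_add_sum_sdiff F t a]

section

variable {r : ℕ} (S : Set (MvPolynomial (Fin r) ℤ))

/-- The common zeros of `S` in `(ℤ/mℤ)^r`. -/
def residueZeros (m : ℕ) : Set (Fin r → ZMod m) :=
  {x | ∀ f ∈ S, eval x (map (Int.castRingHom (ZMod m)) f) = 0}

/-- The proportion of common zeros of `S` in `(ℤ/mℤ)^r`. -/
noncomputable def zeroDensity (m : ℕ) : ℝ :=
  ((residueZeros S m).ncard : ℝ) / (m : ℝ) ^ r

/-- The integer points that survive the sieve by the primes of `F`: none of these primes divides all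
values of the members of `S`. -/
def sifted (F : Set Nat.Primes) : Set (Fin r → ℤ) :=
  {n | ∀ p ∈ F, n ∉ zerosMod S p}

theorem reduceMod_mem_residueZeros_iff {m : ℕ} {n : Fin r → ℤ} :
    reduceMod m n ∈ residueZeros S m ↔ n ∈ zerosMod S m :=
  forall₂_congr fun _ _ => eval_reduceMod_eq_zero_iff

theorem card_compl_residueZeros_div (m : ℕ) [NeZero m] [Fintype (residueZeros S m)]
    [DecidableEq (Fin r → ZMod m)] :
    (((residueZeros S m).toFinsetᶜ).card : ℝ) / (m : ℝ) ^ r = 1 - zeroDensity S m := by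
  have hm : (m : ℝ) ^ r ≠ 0 := pow_ne_zero _ (Nat.cast_ne_zero.2 (NeZero.ne m))
  rw [eq_sub_iff_add_eq, zeroDensity, ← add_div, div_eq_one_iff_eq hm,
    Set.ncard_eq_toFinset_card', ← Nat.cast_add, Finset.card_compl_add_card, Fintype.card_fun,
    ZMod.card, Fintype.card_fin, Nat.cast_pow]

theorem zeroDensity_nonneg (m : ℕ) : 0 ≤ zeroDensity S m := by
  unfold zeroDensity
  positivity

theorem zeroDensity_le_one (m : ℕ) [NeZero m] : zeroDensity S m ≤ 1 := by
  classical
  rw [← sub_nonneg, ← card_compl_residueZeros_div]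
  positivity

theorem hasDensity_sifted (F : Finset Nat.Primes) :
    HasDensity (sifted S F) (∏ p ∈ F, (1 - zeroDensity S p)) := by
  classical
  have (p : F) : NeZero ((p : Nat.Primes) : ℕ) := ⟨p.1.2.ne_zero⟩
  have hcop : Pairwise (Function.onFun Nat.Coprime fun p : F => ((p : Nat.Primes) : ℕ)) :=
    fun p q hpq => (Nat.coprime_primes p.1.2 q.1.2).2 fun h => hpq (Subtype.ext (Subtype.ext h))
  have hset : sifted S F = {n | ∀ p : F, reduceMod ((p : Nat.Primes) : ℕ) n ∈
      ((residueZeros S ((p : Nat.Primes) : ℕ)).toFinsetᶜ : Finset _)} := by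
    ext n
    simp [sifted, reduceMod_mem_residueZeros_iff]
  rw [hset, ← Finset.prod_coe_sort]
  simp only [← card_compl_residueZeros_div]
  exact hasDensity_pi_reduceMod _ hcop _

theorem sifted_subset_union_largePrimeZeros {F F' : Set Nat.Primes} {M : ℕ}
    (h : ∀ p ∈ F', p ∈ F ∨ M < (p : ℕ)) : sifted S F ⊆ sifted S F' ∪ largePrimeZeros S M := by
  intro n hn
  by_cases hlarge : n ∈ largePrimeZeros S M
  · exact Or.inr hlarge
  · exact Or.inl fun p hp hpn =>
      (h p hp).elim (fun hpF => hn p hpF hpn) fun hMp => hlarge ⟨p, p.2, hMp, hpn⟩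

end

theorem finite_primes_le (M : ℕ) : {p : Nat.Primes | (p : ℕ) ≤ M}.Finite :=
  (Set.finite_Iic M).preimage Subtype.val_injective.injOn

variable {r : ℕ} {S : Set (MvPolynomial (Fin r) ℤ)}

theorem NegligibleLargePrimes.summable_zeroDensity (hS : NegligibleLargePrimes S) :
    Summable fun p : Nat.Primes => zeroDensity S p := by
  obtain ⟨M, hM⟩ := (hS (1 / 2) (by norm_num)).exists
  refine summable_of_le_prod_one_sub (finite_primes_le M).toFinset (fun p => zeroDensity_nonneg S p)
    (fun p => have : NeZero (p : ℕ) := ⟨p.2.ne_zero⟩; zeroDensity_le_one S p)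
    (c := 1 / 2) (by norm_num) fun F hF => ?_
  have hsub := sifted_subset_union_largePrimeZeros S (F := (∅ : Finset Nat.Primes)) (F' := F)
    (M := M) fun p hp => Or.inr <| by simpa using Finset.disjoint_left.1 hF hp
  have hle := (hasDensity_sifted S ∅).le_add_of_subset_union (hasDensity_sifted S F) hsub hM
  rw [Finset.prod_empty] at hle
  linarith

theorem NegligibleLargePrimes.multipliable_one_sub_zeroDensity (hS : NegligibleLargePrimes S) :
    Multipliable fun p : Nat.Primes => 1 - zeroDensity S p := by
  simpa only [sub_eq_add_neg] using
    Real.multipliable_one_add_of_summable hS.summable_zeroDensity.neg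

theorem NegligibleLargePrimes.hasDensity_sifted_univ (hS : NegligibleLargePrimes S) :
    HasDensity (sifted S Set.univ) (∏' p : Nat.Primes, (1 - zeroDensity S p)) := by
  refine Metric.tendsto_nhds.2 fun ε hε => ?_
  have hε3 : 0 < ε / 3 := by positivity
  obtain ⟨M, hM⟩ := (hS _ hε3).exists
  obtain ⟨F, hFd, hFM⟩ := ((Metric.tendsto_nhds.1 hS.multipliable_one_sub_zeroDensity.hasProd _
    hε3).and (eventually_ge_atTop (finite_primes_le M).toFinset)).exists
  filter_upwards [hM, Metric.tendsto_nhds.1 (hasDensity_sifted S F) _ hε3] with B hMB hFB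
  have hupper : proportion (box r B) (sifted S Set.univ) ≤ proportion (box r B) (sifted S F) :=
    proportion_mono fun n _ hn p _ => hn p trivial
  have hlower : proportion (box r B) (sifted S F) ≤
      proportion (box r B) (sifted S Set.univ) + proportion (box r B) (largePrimeZeros S M) := by
    refine (proportion_mono fun n _ hn => ?_).trans proportion_union_le
    refine sifted_subset_union_largePrimeZeros S (fun p _ => ?_) hn
    exact (le_or_gt (p : ℕ) M).imp_left fun hpM => hFM (by simpa using hpM)
  change dist (proportion _ _) _ < _ at hFB ⊢
  rw [Real.dist_eq, abs_lt] at hFd hFB ⊢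
  constructor <;> linarith

theorem coprimeValueSet_eq_sifted {s : ℕ} (P : Fin s → MvPolynomial (Fin r) ℤ) :
    coprimeValueSet P = sifted (Set.range P) Set.univ := by
  ext n
  have hdvd (p : ℕ) : p ∣ (Finset.univ.gcd fun i => eval n (P i)).natAbs ↔
      n ∈ zerosMod (Set.range P) p := by
    rw [← Int.natCast_dvd, Finset.dvd_gcd_iff]
    simp [zerosMod]
  calc Finset.univ.gcd (fun i => eval n (P i)) = 1
      ↔ (Finset.univ.gcd fun i => eval n (P i)).natAbs = 1 := by
        rw [← Int.isUnit_iff_natAbs_eq, ← normalize_eq_one, Finset.normalize_gcd]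
    _ ↔ ∀ p : ℕ, p.Prime → n ∉ zerosMod (Set.range P) p := by
        simp only [Nat.eq_one_iff_not_exists_prime_dvd, hdvd]
    _ ↔ n ∈ sifted (Set.range P) Set.univ :=
        ⟨fun h p _ => h p p.2, fun h p hp => h ⟨p, hp⟩ trivial⟩

theorem commonZeros_div_eq_zeroDensity {s : ℕ} (P : Fin s → MvPolynomial (Fin r) ℤ) (p : ℕ) :
    (commonZeros P p : ℝ) / (p : ℝ) ^ r = zeroDensity (Set.range P) p := by
  simp only [commonZeros, zeroDensity, residueZeros, Set.forall_mem_range]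

end Sieve

end EkedahlPoonen

theorem theorem1p5 (r s : ℕ) (hr : 1 ≤ r) (hs : 2 ≤ s)
    (P : Fin s → MvPolynomial (Fin r) ℤ) (hP : ∀ i, P i ≠ 0)
    (hcop : EkedahlPoonen.CoprimePolys P) :
    Multipliable (fun p : Nat.Primes =>
        1 - (EkedahlPoonen.commonZeros P (p : ℕ) : ℝ) / ((p : ℕ) : ℝ) ^ r) ∧
      EkedahlPoonen.HasDensity (EkedahlPoonen.coprimeValueSet P)
        (∏' p : Nat.Primes,
          (1 - (EkedahlPoonen.commonZeros P (p : ℕ) : ℝ) / ((p : ℕ) : ℝ) ^ r)) := by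
  have hnegl : EkedahlPoonen.NegligibleLargePrimes (Set.range P) :=
    hcop.commonDivisorsConstant.negligibleLargePrimes (Set.finite_range P)
      ⟨_, ⟨⟨0, by omega⟩, rfl⟩, hP _⟩
  simp only [EkedahlPoonen.commonZeros_div_eq_zeroDensity,
    EkedahlPoonen.coprimeValueSet_eq_sifted]
  exact ⟨hnegl.multipliable_one_sub_zeroDensity, hnegl.hasDensity_sifted_univ⟩
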